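/- For $n\ge 1$ let $l_\infty^n$ be $\mathbb{R}^n$ with the supremum norm and standard basis $e_1,\dots,e_n$. In a metric space $(X,d)$, a non-empty subset $A$ is *externally hyperconvex in $X$* if for every family of closed balls $B(x_i,r_i)$, $i\in I$, in $X$ with $d(x_i,x_j)\le r_i+r_j$ and $d(x_i,A)\le r_i$ for all $i,j\in I$ one has $A\cap\bigcap_{i\in I}B(x_i,r_i)\ne\emptyset$; $A$ is *weakly externally hyperconvex in $X$* if for every $x\in X$ it is externally hyperconvex in the subspace $A\cup\{x\}$. A non-empty subset $S\subset X$ is *strongly convex* if $z\in S$ whenever $x,y\in S$, $z\in X$ and $d(x,z)+d(z,y)=d(x,y)$. **Theorem.** Let $n\ge 1$ and let $V$ be a linear subspace of $l_\infty^n$. The following are equivalent. 1. $V$ is weakly externally hyperconvex in $l_\infty^n$. 2. $V$ is the intersection of a (possibly empty) set of hyperplanes $\{x : x\cdot v=0\}$ whose normals $v\neq 0$ are of the form $v=\sigma e_i$ or $v=\sigma e_i+\tau e_j$ with $\sigma,\tau\in\{1,-1\}$ and $i,j\in\{1,\dots,n\}$ (the intersection of the empty set of hyperplanes being $l_\infty^n$).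 3. There are integers $k,m,q\ge 0$ and $p_1,\dots,p_q$ and one-dimensional strongly convex linear subspaces $S_{p_j}\subset l_\infty^{p_j}$ $(1\le j\le q)$ such that, after a permutation of the coordinates, $$V=\{0\}^k\times l_\infty^m\times S_{p_1}\times\cdots\times S_{p_q}.$$ Moreover, for every representation as in (3), one has $n=k+m+\sum_{j}p_j$ and $\dim V=m+q$, and each $S_{p_j}$ is spanned by a vertex of the cube $[-1,1]^{p_j}$, that is, by a vector all of whose entries are $\pm1$. -/

import Mathlib

universe u

/-- A non-empty subset `A` of a metric space `X` is externally hyperconvex in `X` if every family of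
closed balls `B(x i, r i)` of `X` with `d(x i, x j) ≤ r i + r j` and `d(x i, A) ≤ r i` has a common
point in `A`. -/
def IsExternallyHyperconvex {X : Type u} [MetricSpace X] (A : Set X) : Prop :=
  A.Nonempty ∧ ∀ (ι : Type u) (x : ι → X) (r : ι → ℝ),
    (∀ i j, dist (x i) (x j) ≤ r i + r j) → (∀ i, Metric.infDist (x i) A ≤ r i) →
      (A ∩ ⋂ i, Metric.closedBall (x i) (r i)).Nonempty

/-- `A` is weakly externally hyperconvex in `X` if, for every `x : X`, it is externally hyperconvex
in the metric subspace `A ∪ {x}`. The set `A` is non-empty by convention; this is a separate clause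
because `X` may be empty. -/
def IsWeaklyExternallyHyperconvex {X : Type u} [MetricSpace X] (A : Set X) : Prop :=
  A.Nonempty ∧ ∀ x : X,
    IsExternallyHyperconvex (X := ↥(A ∪ {x})) ((Subtype.val : ↥(A ∪ {x}) → X) ⁻¹' A)

/-- The metric interval `I(x, y)`. -/
def metricInterval {X : Type u} [MetricSpace X] (x y : X) : Set X :=
  {z | dist x z + dist z y = dist x y}

/-- Strongly convex subsets of a metric space. -/
def IsStronglyConvexSet {X : Type u} [MetricSpace X] (S : Set X) : Prop :=
  S.Nonempty ∧ ∀ x ∈ S, ∀ y ∈ S, metricInterval x y ⊆ S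

/-- The set of points of `ℝ^n` orthogonal to `v`; a hyperplane when `v ≠ 0`. -/
def hyperplaneWithNormal {n : ℕ} (v : Fin n → ℝ) : Set (Fin n → ℝ) :=
  {x | x ⬝ᵥ v = 0}

/-- The non-zero vectors of the form `σ e_i` or `σ e_i + τ e_j` with signs `σ, τ`. The vector
`σ e_i - σ e_i = 0` is not the normal of a hyperplane and is excluded. -/
def IsSignedNormal {n : ℕ} (v : Fin n → ℝ) : Prop :=
  v ≠ 0 ∧ ∃ σ τ : ℝ, (σ = 1 ∨ σ = -1) ∧ (τ = 1 ∨ τ = -1) ∧ ∃ i j : Fin n,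
    v = Pi.single i σ ∨ v = Pi.single i σ + Pi.single j τ

/-- The subset `{0}^k × ℝ^m × S_1 × ⋯ × S_q` of `ℝ^k × ℝ^m × ℝ^{p_1} × ⋯ × ℝ^{p_q}`, whose
coordinates are indexed by the disjoint union of the index sets of the factors. -/
def blockProduct (k m : ℕ) {q : ℕ} {p : Fin q → ℕ}
    (S : (j : Fin q) → Submodule ℝ (Fin (p j) → ℝ)) :
    Set (Fin k ⊕ Fin m ⊕ ((j : Fin q) × Fin (p j)) → ℝ) :=
  {y | (∀ i : Fin k, y (Sum.inl i) = 0) ∧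
    ∀ j : Fin q, (fun l : Fin (p j) => y (Sum.inr (Sum.inr ⟨j, l⟩))) ∈ S j}

/-- `V` is, after the relabelling `e` of the coordinates, the product
`{0}^k × l_∞^m × S_1 × ⋯ × S_q` with each `S_j` a one-dimensional strongly convex linear subspace
of `l_∞^{p_j}`. -/
def IsStronglyConvexLineProduct {n : ℕ} (V : Submodule ℝ (Fin n → ℝ)) (k m : ℕ) {q : ℕ}
    {p : Fin q → ℕ} (S : (j : Fin q) → Submodule ℝ (Fin (p j) → ℝ))
    (e : Fin n ≃ Fin k ⊕ Fin m ⊕ ((j : Fin q) × Fin (p j))) : Prop :=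
  (∀ j, Module.finrank ℝ (S j) = 1 ∧ IsStronglyConvexSet (S j : Set (Fin (p j) → ℝ))) ∧
    (V : Set (Fin n → ℝ)) = {x | (fun c => x (e.symm c)) ∈ blockProduct k m S}

/-! All three conditions are compared with `IsSignedPullback`: each coordinate on `V` is zero or
plus or minus a free parameter. For such `V`, ball intersection splits into one-dimensional Helly
problems, one per parameter.

The hard direction is `IsWeaklyExternallyHyperconvex.isSignedPullback`. Take a minimal set `I` of
coordinates norming `V`. Balls with centres in `V` already force the restriction of `V` to `I` to be
onto, so `V` is isometric to the sup-norm space on `I` (`exists_mem_forall_apply_eq`). Any other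
coordinate is a functional on that space of `ℓ₁`-norm at most 1; a ball about one point outside `V`
shows that it is zero or a signed coordinate (`abs_eq_one_of_coeff_ne_zero`).

Hyperplanes with signed normals encode the same identifications of coordinates. Grouping coordinates
by parameter gives the product, because strongly convex lines are exactly those spanned by sign
vectors. -/

/-- `V` consists of the vectors whose coordinates are, up to signs, parameters that may be shared
between coordinates, or are zero. -/
def IsSignedPullback {n : ℕ} (V : Submodule ℝ (Fin n → ℝ)) : Prop :=
  ∃ (κ : Type) (c : Fin n → κ) (s : Fin n → ℝ), (∀ i, s i = 0 ∨ s i = 1 ∨ s i = -1) ∧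
    ∀ x, x ∈ V ↔ ∃ t : κ → ℝ, ∀ i, x i = s i * t (c i)

/-! ### Signed pullbacks are weakly externally hyperconvex. -/

theorem infDist_preimage_subtype {X : Type u} [MetricSpace X] (A : Set X) (x : X)
    (z : ↥(A ∪ {x})) :
    Metric.infDist z ((Subtype.val : ↥(A ∪ {x}) → X) ⁻¹' A) = Metric.infDist (z : X) A := by
  rw [← Metric.infDist_image (isometry_subtype_coe (s := A ∪ {x})), Subtype.image_preimage_coe,
    Set.inter_eq_right.2 Set.subset_union_left]

theorem isWeaklyExternallyHyperconvex_iff {X : Type u} [MetricSpace X] (A : Set X) :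
    IsWeaklyExternallyHyperconvex A ↔ A.Nonempty ∧
      ∀ (x : X) (ι : Type u) (z : ι → X) (r : ι → ℝ), (∀ i, z i ∈ A ∪ {x}) →
        (∀ i j, dist (z i) (z j) ≤ r i + r j) → (∀ i, Metric.infDist (z i) A ≤ r i) →
          ∃ y ∈ A, ∀ i, dist y (z i) ≤ r i := by
  constructor
  · rintro ⟨hA, h⟩
    refine ⟨hA, fun x ι z r hz hd hi => ?_⟩
    obtain ⟨y, hy, hy'⟩ := (h x).2 ι (fun i => ⟨z i, hz i⟩) r hd
      (fun i => by rw [infDist_preimage_subtype]; exact hi i)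
    exact ⟨y, hy, fun i => Set.mem_iInter.1 hy' i⟩
  · rintro ⟨hA, h⟩
    refine ⟨hA, fun x => ⟨?_, fun ι z r hd hi => ?_⟩⟩
    · obtain ⟨a, ha⟩ := hA
      exact ⟨⟨a, Or.inl ha⟩, ha⟩
    · obtain ⟨y, hy, hy'⟩ := h x ι (fun i => z i) r (fun i => (z i).2) hd
        (fun i => by rw [← infDist_preimage_subtype A x]; exact hi i)
      exact ⟨⟨y, Or.inl hy⟩, hy, Set.mem_iInter.2 hy'⟩

/-- Pairwise intersecting compact intervals have a common point. -/
theorem exists_forall_abs_sub_le {ι : Type*} (a r : ι → ℝ)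
    (h : ∀ i j, |a i - a j| ≤ r i + r j) : ∃ t, ∀ i, |t - a i| ≤ r i := by
  rcases isEmpty_or_nonempty ι with hι | hι
  · exact ⟨0, fun i => isEmptyElim i⟩
  have hle : ∀ i j, a i - r i ≤ a j + r j := fun i j => by
    have := (abs_le.1 (h i j)).2
    linarith
  refine ⟨⨆ i, (a i - r i), fun j => ?_⟩
  have h1 : (⨆ i, (a i - r i)) ≤ a j + r j := ciSup_le fun i => hle i j
  have h2 : a j - r j ≤ ⨆ i, (a i - r i) :=
    le_ciSup (f := fun i => a i - r i)
      ⟨a j + r j, by rintro _ ⟨i, rfl⟩; exact hle i j⟩ j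
  exact abs_le.2 ⟨by linarith, by linarith⟩

theorem abs_apply_le_norm {n : ℕ} (x : Fin n → ℝ) (i : Fin n) : |x i| ≤ ‖x‖ := by
  simpa [Real.norm_eq_abs] using norm_le_pi_norm x i

theorem abs_sub_le_of_dist_le {n : ℕ} {x y : Fin n → ℝ} {r : ℝ} (h : dist x y ≤ r) (i : Fin n) :
    |x i - y i| ≤ r := by
  rw [dist_eq_norm] at h
  exact (abs_apply_le_norm (x - y) i).trans h

theorem dist_le_of_abs_sub_le {n : ℕ} {x y : Fin n → ℝ} {r : ℝ} (hr : 0 ≤ r)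
    (h : ∀ i, |x i - y i| ≤ r) : dist x y ≤ r :=
  (dist_pi_le_iff hr).2 fun i => by simpa [Real.dist_eq] using h i

theorem exists_abs_sub_le_infDist_add {n : ℕ} {V : Submodule ℝ (Fin n → ℝ)} {κ : Type}
    {c : Fin n → κ} {s : Fin n → ℝ}
    (hV : ∀ x, x ∈ V ↔ ∃ t : κ → ℝ, ∀ i, x i = s i * t (c i))
    (x : Fin n → ℝ) {δ : ℝ} (hδ : 0 < δ) :
    ∃ t : κ → ℝ, ∀ i, |x i - s i * t (c i)| ≤ Metric.infDist x V + δ := by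
  obtain ⟨v, hv, hd⟩ := (Metric.infDist_lt_iff (s := (V : Set (Fin n → ℝ))) ⟨0, V.zero_mem⟩).1
    (show Metric.infDist x (V : Set (Fin n → ℝ)) < Metric.infDist x V + δ by linarith)
  obtain ⟨t, ht⟩ := (hV v).1 hv
  exact ⟨t, fun i => ht i ▸ abs_sub_le_of_dist_le hd.le i⟩

/-- For each parameter, the balls and the coordinates carrying it give intervals on the line. They
meet pairwise: a centre in `V` has the same signed value on all these coordinates, while the spread
of the values of `x` is controlled by its distance to `V`. -/
theorem IsSignedPullback.isWeaklyExternallyHyperconvex {n : ℕ} {V : Submodule ℝ (Fin n → ℝ)}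
    (h : IsSignedPullback V) : IsWeaklyExternallyHyperconvex (V : Set (Fin n → ℝ)) := by
  obtain ⟨κ, c, s, hs, hV⟩ := h
  rw [isWeaklyExternallyHyperconvex_iff]
  refine ⟨⟨0, V.zero_mem⟩, fun x ι z r hz hd hi => ?_⟩
  have hr : ∀ i, 0 ≤ r i := fun i => Metric.infDist_nonneg.trans (hi i)
  have hsq : ∀ l, s l ≠ 0 → s l * s l = 1 := fun l hl => by
    rcases hs l with h | h | h
    · exact absurd h hl
    · simp [h]
    · simp [h]
  have habs : ∀ l, s l ≠ 0 → |s l| = 1 := fun l hl => by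
    rcases hs l with h | h | h
    · exact absurd h hl
    · simp [h]
    · simp [h]
  have hmul : ∀ l, s l ≠ 0 → ∀ a b : ℝ, |s l * a - b| = |a - s l * b| := fun l hl a b => by
    rw [← one_mul |a - s l * b|, ← habs l hl, ← abs_mul, mul_sub, ← mul_assoc, hsq l hl, one_mul]
  have hmem : ∀ i, z i ∈ V → ∀ l l', c l = c l' → s l ≠ 0 → s l' ≠ 0 →
      s l * z i l = s l' * z i l' := by
    intro i hzi l l' hc hl hl'
    obtain ⟨t, ht⟩ := (hV _).1 hzi
    rw [ht l, ht l', ← mul_assoc, ← mul_assoc, hsq l hl, hsq l' hl', hc]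
  have hsame : ∀ i j l, s l ≠ 0 → |s l * z i l - s l * z j l| ≤ r i + r j := by
    intro i j l hl
    rw [← mul_sub, abs_mul, habs l hl, one_mul]
    exact abs_sub_le_of_dist_le (hd i j) l
  have key : ∀ a : κ, ∃ t : ℝ, ∀ (i : ι) (l : Fin n), c l = a → s l ≠ 0 →
      |t - s l * z i l| ≤ r i := by
    intro a
    obtain ⟨t, ht⟩ := exists_forall_abs_sub_le
      (ι := ι × {l : Fin n // c l = a ∧ s l ≠ 0})
      (fun w => s w.2 * z w.1 w.2) (fun w => r w.1) (by
        rintro ⟨i, l, hl, hsl⟩ ⟨j, l', hl', hsl'⟩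
        change |s l * z i l - s l' * z j l'| ≤ r i + r j
        rcases hz i with hzi | hzi
        · rw [hmem i hzi l l' (hl.trans hl'.symm) hsl hsl']
          exact hsame i j l' hsl'
        rcases hz j with hzj | hzj
        · rw [hmem j hzj l' l (hl'.trans hl.symm) hsl' hsl]
          exact hsame i j l hsl
        have hij : z i = z j := hzi.trans hzj.symm
        refine le_of_forall_pos_le_add fun δ hδ => ?_
        obtain ⟨t, ht⟩ := exists_abs_sub_le_infDist_add hV (z i) (half_pos hδ)
        have h1 := ht l
        have h2 := ht l'
        rw [abs_sub_comm, hmul l hsl] at h1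
        rw [abs_sub_comm, hmul l' hsl'] at h2
        have h3 := hi i
        have h4 := hi j
        rw [← hij] at h4 ⊢
        rw [hl] at h1
        rw [hl'] at h2
        have := abs_sub_le (s l * z i l) (t a) (s l' * z i l')
        rw [abs_sub_comm _ (t a)] at this
        linarith)
    exact ⟨t, fun i l hl hsl => ht ⟨i, l, hl, hsl⟩⟩
  choose t ht using key
  refine ⟨fun l => s l * t (c l), (hV _).2 ⟨t, fun _ => rfl⟩, fun i => ?_⟩
  refine dist_le_of_abs_sub_le (hr i) fun l => ?_
  by_cases hl : s l = 0
  · rcases hz i with hzi | hzi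
    · obtain ⟨t', ht'⟩ := (hV _).1 hzi
      simpa [ht' l, hl] using hr i
    -- On a coordinate vanishing on `V`, the modulus of the entry of `x` is at most the distance
    -- from `x` to `V`.
    · refine le_of_forall_pos_le_add fun δ hδ => ?_
      obtain ⟨t', ht'⟩ := exists_abs_sub_le_infDist_add hV (z i) hδ
      have := ht' l
      simp only [hl, zero_mul, sub_zero, zero_sub, abs_neg] at this ⊢
      linarith [hi i]
  · rw [hmul l hl]
    exact ht (c l) i l rfl hl

/-! ### Weakly externally hyperconvex subspaces are signed pullbacks. -/

/-- A subspace `V` of `l_∞^n` has a minimal set of coordinates that computes the norm on `V`; each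
of these coordinates is then the only one of maximal modulus on some vector of `V`. -/
theorem exists_minimal_norming {n : ℕ} (V : Submodule ℝ (Fin n → ℝ)) :
    ∃ I : Finset (Fin n),
      (∀ v ∈ V, ∀ R : ℝ, 0 ≤ R → (∀ i ∈ I, |v i| ≤ R) → ∀ j, |v j| ≤ R) ∧
      ∀ i ∈ I, ∃ p ∈ V, p i = 1 ∧ ∀ k ∈ I, k ≠ i → |p k| < 1 := by
  classical
  obtain ⟨I, hI, hmin⟩ := exists_minimal_of_wellFoundedLT
    (fun I : Finset (Fin n) =>
      ∀ v ∈ V, ∀ R : ℝ, 0 ≤ R → (∀ i ∈ I, |v i| ≤ R) → ∀ j, |v j| ≤ R)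
    ⟨Finset.univ, fun v _ R _ h j => h j (Finset.mem_univ j)⟩
  refine ⟨I, hI, fun i hi => ?_⟩
  -- By minimality, `I` without `i` is not norming; a witness of this, rescaled, peaks only at `i`
  -- within `I`.
  have hnot : ¬ ∀ v ∈ V, ∀ R : ℝ, 0 ≤ R → (∀ k ∈ I.erase i, |v k| ≤ R) → ∀ j, |v j| ≤ R :=
    fun h => Finset.notMem_erase i I (hmin h (Finset.erase_subset i I) hi)
  push Not at hnot
  obtain ⟨v, hv, R, hR, hle, j, hj⟩ := hnot
  have hvi : R < |v i| := by
    by_contra! hcon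
    refine hj.not_ge (hI v hv R hR (fun k hk => ?_) j)
    by_cases hki : k = i
    · exact hki ▸ hcon
    · exact hle k (Finset.mem_erase.2 ⟨hki, hk⟩)
  have hpos : 0 < |v i| := hR.trans_lt hvi
  refine ⟨(v i)⁻¹ • v, V.smul_mem _ hv, ?_, fun k hk hki => ?_⟩
  · simp [abs_pos.1 hpos]
  · rw [Pi.smul_apply, smul_eq_mul, abs_mul, abs_inv, inv_mul_lt_iff₀ hpos, mul_one]
    exact (hle k (Finset.mem_erase.2 ⟨hki, hk⟩)).trans_lt hvi

/-- The coordinates in a minimal norming set take arbitrary values on a weakly externally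
hyperconvex subspace. -/
theorem exists_mem_forall_apply_eq {n : ℕ} {V : Submodule ℝ (Fin n → ℝ)}
    (hV : IsWeaklyExternallyHyperconvex (V : Set (Fin n → ℝ))) {I : Finset (Fin n)}
    (hI : ∀ v ∈ V, ∀ R : ℝ, 0 ≤ R → (∀ i ∈ I, |v i| ≤ R) → ∀ j, |v j| ≤ R)
    (hp : ∀ i ∈ I, ∃ p ∈ V, p i = 1 ∧ ∀ k ∈ I, k ≠ i → |p k| < 1) (t : Fin n → ℝ) :
    ∃ y ∈ V, ∀ i ∈ I, y i = t i := by
  classical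
  choose! p hpV hp1 hplt using hp
  obtain ⟨μ, hμ, hμ0, hμ1⟩ : ∃ μ : ℝ, (∀ i ∈ I, ∀ k ∈ I, k ≠ i → |p i k| ≤ μ) ∧ 0 ≤ μ ∧ μ < 1 := by
    have h1 : ∀ᶠ μ in nhdsWithin (1 : ℝ) (Set.Iio 1), ∀ i ∈ I, ∀ k ∈ I, k ≠ i → |p i k| ≤ μ := by
      rw [Filter.eventually_all_finset]
      intro i hi
      rw [Filter.eventually_all_finset]
      intro k hk
      by_cases hki : k = i
      · simp [hki]
      · filter_upwards [eventually_nhdsWithin_of_eventually_nhds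
          (eventually_ge_nhds (hplt i hi k hk hki))] with μ h _ using h
    have h2 : ∀ᶠ μ in nhdsWithin (1 : ℝ) (Set.Iio 1), 0 ≤ μ :=
      eventually_nhdsWithin_of_eventually_nhds (eventually_ge_nhds one_pos)
    exact (h1.and (h2.and self_mem_nhdsWithin)).exists
  set T := ‖t‖
  have hT : 0 ≤ T := norm_nonneg t
  have htT : ∀ i, |t i| ≤ T := abs_apply_le_norm t
  -- Chosen so that `L * (1 + μ) = 2 * L - 2 * T`, a lower bound for the sum of any two radii below.
  set L := 2 * T / (1 - μ)
  have hL : L * (1 - μ) = 2 * T := div_mul_cancel₀ _ (by linarith)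
  have hL0 : 0 ≤ L := div_nonneg (by linarith) (by linarith)
  have hLT : T ≤ L := by nlinarith
  have hp1' : ∀ i ∈ I, ∀ k ∈ I, |p i k| ≤ 1 := fun i hi k hk => by
    by_cases hki : k = i
    · rw [hki, hp1 i hi, abs_one]
    · exact (hplt i hi k hk hki).le
  let sg : Bool → ℝ := fun b => if b then 1 else -1
  have hsg : ∀ b, |sg b| = 1 := fun b => by cases b <;> simp [sg]
  have hst : ∀ b i, sg b * t i ≤ T := fun b i =>
    (le_abs_self _).trans (by rw [abs_mul, hsg, one_mul]; exact htT i)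
  have hzV : ∀ w : I × Bool, (sg w.2 * L) • p w.1 ∈ V := fun w => V.smul_mem _ (hpV w.1 w.1.2)
  -- Large balls about `L • p i` and `-L • p i` act as the half-spaces `t i ≤ y i` and `y i ≤ t i`.
  obtain ⟨y, hy, hy'⟩ := ((isWeaklyExternallyHyperconvex_iff _).1 hV).2 0 (I × Bool)
    (fun w => (sg w.2 * L) • p w.1) (fun w => L - sg w.2 * t w.1)
    (fun w => Or.inl (hzV w)) (by
      rintro ⟨⟨i, hi⟩, b⟩ ⟨⟨k, hk⟩, b'⟩
      have hbi := hst b i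
      have hbk := hst b' k
      have hR : 0 ≤ L - sg b * t i + (L - sg b' * t k) := by linarith
      refine dist_le_of_abs_sub_le hR fun j => ?_
      refine hI _ (V.sub_mem (hzV ⟨⟨i, hi⟩, b⟩) (hzV ⟨⟨k, hk⟩, b'⟩)) _ hR (fun l hl => ?_) j
      simp only [Pi.sub_apply, Pi.smul_apply, smul_eq_mul]
      by_cases hik : i = k
      · subst hik
        have h1 := abs_le.1 (hp1' i hi l hl)
        cases b <;> cases b' <;> simp only [sg, if_true, Bool.false_eq_true, if_false] at hR ⊢
        · simpa using hR
        · rw [abs_le]; constructor <;> nlinarith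
        · rw [abs_le]; constructor <;> nlinarith
        · simpa using hR
      -- No coordinate in `I` is a peak of both vectors.
      · have hbound : |p i l| + |p k l| ≤ 1 + μ := by
          by_cases hli : l = i
          · have := hμ k hk l hl (fun h => hik (hli.symm.trans h))
            linarith [hp1' i hi l hl]
          · linarith [hμ i hi l hl hli, hp1' k hk l hl]
        calc |sg b * L * p i l - sg b' * L * p k l|
            ≤ |sg b * L * p i l| + |sg b' * L * p k l| := abs_sub _ _
          _ = L * (|p i l| + |p k l|) := by
            simp only [abs_mul, hsg, abs_of_nonneg hL0]; ring
          _ ≤ L * (1 + μ) := mul_le_mul_of_nonneg_left hbound hL0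
          _ ≤ _ := by nlinarith)
    (fun w => by
      rw [Metric.infDist_zero_of_mem (hzV w)]
      linarith [hst w.2 w.1])
  refine ⟨y, hy, fun i hi => ?_⟩
  have h1 := abs_sub_le_of_dist_le (hy' ⟨⟨i, hi⟩, true⟩) i
  have h2 := abs_sub_le_of_dist_le (hy' ⟨⟨i, hi⟩, false⟩) i
  simp only [Pi.smul_apply, smul_eq_mul, sg, if_true, Bool.false_eq_true, if_false,
    hp1 i hi] at h1 h2
  rw [abs_le] at h1 h2
  linarith

/-- If the conclusion fails, then `D > 0`. A point of `V` in the unit ball about `x = (1 + C) e_j`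
must maximise coordinate `j` over the unit ball of `V`, hence have the sign of `a i₀` at `i₀`. The
unit ball about `v` forbids this, yet `v` lies within 2 of `x`. -/
theorem abs_eq_one_of_coeff_ne_zero {n : ℕ} {V : Submodule ℝ (Fin n → ℝ)}
    (hV : IsWeaklyExternallyHyperconvex (V : Set (Fin n → ℝ))) {I : Finset (Fin n)}
    (hI : ∀ v ∈ V, ∀ R : ℝ, 0 ≤ R → (∀ i ∈ I, |v i| ≤ R) → ∀ j, |v j| ≤ R)
    (hsurj : ∀ t : Fin n → ℝ, ∃ y ∈ V, ∀ i ∈ I, y i = t i)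
    {j : Fin n} (hj : j ∉ I) {a : Fin n → ℝ} (ha : ∀ v ∈ V, v j = ∑ i ∈ I, a i * v i)
    {i₀ : Fin n} (hi₀ : i₀ ∈ I) (ha₀ : a i₀ ≠ 0) :
    |a i₀| = 1 ∧ ∀ i ∈ I, i ≠ i₀ → a i = 0 := by
  classical
  have hsign : ∀ x : ℝ, |(SignType.sign x : ℝ)| ≤ 1 := fun x => by
    rcases lt_trichotomy x 0 with h | h | h <;> simp [h]
  have hsm : ∀ x : ℝ, x * SignType.sign x = |x| := fun x => by
    rw [mul_comm]; exact sign_mul_self x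
  set C := ∑ i ∈ I, |a i|
  have hCnn : 0 ≤ C := Finset.sum_nonneg fun _ _ => abs_nonneg _
  have hsplit : |a i₀| + ∑ i ∈ I.erase i₀, |a i| = C :=
    Finset.add_sum_erase I (fun i => |a i|) hi₀
  obtain ⟨u, hu, hu'⟩ := hsurj (fun i => SignType.sign (a i))
  have huj : u j = C := by
    rw [ha u hu]
    exact Finset.sum_congr rfl fun i hi => by rw [hu' i hi, hsm]
  have hu1 : ∀ k, |u k| ≤ 1 := hI u hu 1 zero_le_one fun i hi => by
    rw [hu' i hi]; exact hsign _
  have hC1 : C ≤ 1 := by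
    have := hu1 j
    rwa [huj, abs_of_nonneg hCnn] at this
  have hrest : 0 ≤ ∑ i ∈ I.erase i₀, |a i| := Finset.sum_nonneg fun _ _ => abs_nonneg _
  have hpos : 0 < |a i₀| := abs_pos.2 ha₀
  -- This value gives `v j - (C - 1) = D * (1 - |a i₀|)`, which is nonnegative, as needed for `dist
  -- x v ≤ 2`.
  set D := 1 + C - 2 * |a i₀| with hD
  suffices hD0 : D ≤ 0 by
    have h1 : |a i₀| = 1 := by linarith
    have h2 : ∑ i ∈ I.erase i₀, |a i| = 0 := by linarith
    refine ⟨h1, fun i hi hne => abs_eq_zero.1 ?_⟩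
    exact (Finset.sum_eq_zero_iff_of_nonneg fun _ _ => abs_nonneg _).1 h2 i
      (Finset.mem_erase.2 ⟨hne, hi⟩)
  by_contra! hDpos
  obtain ⟨v, hv, hv'⟩ := hsurj
    (fun i => if i = i₀ then -D * SignType.sign (a i) else 2 * SignType.sign (a i))
  have hv2 : ∀ k, |v k| ≤ 2 := hI v hv 2 zero_le_two fun i hi => by
    rw [hv' i hi]
    have := hsign (a i)
    have := abs_nonneg (SignType.sign (a i) : ℝ)
    split_ifs
    · rw [abs_mul, abs_neg, abs_of_pos hDpos]
      nlinarith
    · rw [abs_mul, abs_two]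
      linarith
  have hv₀ : v i₀ = -D * SignType.sign (a i₀) := by simpa using hv' i₀ hi₀
  have hvj : v j = 2 * (C - |a i₀|) - D * |a i₀| := by
    rw [ha v hv, ← Finset.add_sum_erase I _ hi₀, hv₀, ← hsplit, add_sub_cancel_left,
      Finset.mul_sum, ← hsm (a i₀)]
    have : ∀ i ∈ I.erase i₀, a i * v i = 2 * |a i| := fun i hi => by
      rw [hv' i (Finset.mem_of_mem_erase hi), if_neg (Finset.ne_of_mem_erase hi), ← hsm]
      ring
    rw [Finset.sum_congr rfl this]
    ring
  have hvj' : C - 1 ≤ v j := by rw [hvj]; nlinarith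
  set x : Fin n → ℝ := Pi.single j (1 + C) with hx
  have hxj : x j = 1 + C := by simp [hx]
  have hxk : ∀ k, k ≠ j → x k = 0 := fun k hk => by simp [hx, hk]
  have hxu : dist x u ≤ 1 := dist_le_of_abs_sub_le zero_le_one fun k => by
    by_cases hk : k = j
    · rw [hk, hxj, huj]; simp
    · rw [hxk k hk, zero_sub, abs_neg]; exact hu1 k
  have hxv : dist x v ≤ 2 := dist_le_of_abs_sub_le zero_le_two fun k => by
    by_cases hk : k = j
    · have := abs_le.1 (hv2 j)
      rw [hk, hxj, abs_le]
      constructor <;> linarith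
    · rw [hxk k hk, zero_sub, abs_neg]; exact hv2 k
  obtain ⟨y, hy, hy'⟩ := ((isWeaklyExternallyHyperconvex_iff _).1 hV).2 x Bool
    (fun b => if b then x else v) (fun _ => 1)
    (fun b => by cases b <;> simp [hv])
    (fun b b' => by
      cases b <;> cases b' <;> simp only [if_true, Bool.false_eq_true, if_false]
      · simp
      · rw [dist_comm]; linarith
      · linarith
      · simp)
    (fun b => by
      cases b
      · simpa using (Metric.infDist_zero_of_mem hv).trans_le zero_le_one
      · simpa using (Metric.infDist_le_dist_of_mem hu).trans hxu)
  have hyx : dist y x ≤ 1 := by simpa using hy' true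
  have hyv : dist y v ≤ 1 := by simpa using hy' false
  have hyj : C ≤ y j := by
    have := (abs_le.1 (abs_sub_le_of_dist_le hyx j)).1
    rw [hxj] at this
    linarith
  have hyk : ∀ k ∈ I, |y k| ≤ 1 := fun k hk => by
    simpa [hxk k (fun h => hj (h ▸ hk))] using abs_sub_le_of_dist_le hyx k
  have hy₀ : a i₀ * y i₀ ≤ |a i₀| * (1 - D) := by
    have h1 := abs_sub_le_of_dist_le hyv i₀
    have h2 : a i₀ * (y i₀ - v i₀) ≤ |a i₀| * 1 :=
      (le_abs_self _).trans (by rw [abs_mul]; exact mul_le_mul_of_nonneg_left h1 (abs_nonneg _))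
    have h3 : a i₀ * v i₀ = -D * |a i₀| := by rw [hv₀, ← hsm]; ring
    linarith
  have hyrest : ∑ i ∈ I.erase i₀, a i * y i ≤ ∑ i ∈ I.erase i₀, |a i| :=
    Finset.sum_le_sum fun i hi => by
      refine (le_abs_self _).trans ?_
      rw [abs_mul]
      exact mul_le_of_le_one_right (abs_nonneg _) (hyk i (Finset.mem_of_mem_erase hi))
  -- The bounds give `C ≤ y j ≤ C - D * |a i₀|`, a contradiction.
  have := ha y hy
  rw [← Finset.add_sum_erase I _ hi₀] at this
  nlinarith [mul_pos hpos hDpos]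

theorem IsWeaklyExternallyHyperconvex.isSignedPullback {n : ℕ} {V : Submodule ℝ (Fin n → ℝ)}
    (hV : IsWeaklyExternallyHyperconvex (V : Set (Fin n → ℝ))) : IsSignedPullback V := by
  classical
  obtain ⟨I, hI, hp⟩ := exists_minimal_norming V
  have hsurj := exists_mem_forall_apply_eq hV hI hp
  have hext : ∀ v ∈ V, (∀ i ∈ I, v i = 0) → ∀ j, v j = 0 := fun v hv h j =>
    abs_nonpos_iff.1 (hI v hv 0 le_rfl (fun i hi => by simp [h i hi]) j)
  -- For `i ∈ I` these form the basis of `V` dual to the coordinates in `I`.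
  choose b hbV hb using fun i : Fin n => hsurj (Pi.single i 1)
  have hexp : ∀ v ∈ V, ∀ j, v j = ∑ i ∈ I, b i j * v i := fun v hv j => by
    have h := hext (v - ∑ i ∈ I, v i • b i)
      (V.sub_mem hv (V.sum_mem fun i _ => V.smul_mem _ (hbV i))) (fun k hk => by
        have : ∀ i ∈ I, v i * b i k = if i = k then v i else 0 := fun i _ => by
          rw [hb i k hk, Pi.single_apply]
          by_cases h : i = k
          · simp [h]
          · simp [h, Ne.symm h]
        simp [Finset.sum_apply, Finset.sum_congr rfl this, hk]) j
    simp only [Pi.sub_apply, Finset.sum_apply, Pi.smul_apply, smul_eq_mul, sub_eq_zero] at h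
    rw [h]
    exact Finset.sum_congr rfl fun i _ => mul_comm _ _
  have key : ∀ j, ∃ (k : Fin n) (s : ℝ), (s = 0 ∨ s = 1 ∨ s = -1) ∧ (j ∈ I → k = j ∧ s = 1) ∧
      (s ≠ 0 → k ∈ I) ∧ ∀ v ∈ V, v j = s * v k := by
    intro j
    by_cases hj : j ∈ I
    · exact ⟨j, 1, by simp, fun _ => ⟨rfl, rfl⟩, fun _ => hj, by simp⟩
    by_cases hz : ∀ i ∈ I, b i j = 0
    · refine ⟨j, 0, by simp, fun h => absurd h hj, by simp, fun v hv => ?_⟩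
      rw [hexp v hv j, zero_mul]
      exact Finset.sum_eq_zero fun i hi => by rw [hz i hi, zero_mul]
    push Not at hz
    obtain ⟨i, hi, hne⟩ := hz
    obtain ⟨h1, h2⟩ := abs_eq_one_of_coeff_ne_zero hV hI hsurj hj (a := fun i => b i j)
      (fun v hv => hexp v hv j) hi hne
    refine ⟨i, b i j, Or.inr (eq_or_eq_neg_of_abs_eq h1), fun h => absurd h hj, fun _ => hi,
      fun v hv => ?_⟩
    rw [hexp v hv j]
    exact Finset.sum_eq_single_of_mem i hi fun k hk hki => by
      rw [show b k j = 0 from h2 k hk hki, zero_mul]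
  choose c s hs hjI hcI hc using key
  refine ⟨Fin n, c, s, hs, fun x => ⟨fun hx => ⟨x, fun j => hc j x hx⟩, ?_⟩⟩
  rintro ⟨t, ht⟩
  obtain ⟨y, hy, hyt⟩ := hsurj t
  have : x = y := by
    ext j
    rw [ht j, hc j y hy]
    by_cases hsj : s j = 0
    · simp [hsj]
    · rw [hyt _ (hcI j hsj)]
  exact this ▸ hy

/-! ### Hyperplanes with signed normals. -/

theorem mem_hyperplaneWithNormal_single {n : ℕ} (x : Fin n → ℝ) (i : Fin n) (σ : ℝ) :
    x ∈ hyperplaneWithNormal (Pi.single i σ) ↔ x i * σ = 0 := by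
  simp [hyperplaneWithNormal]

theorem mem_hyperplaneWithNormal_add {n : ℕ} (x : Fin n → ℝ) (i j : Fin n) (σ τ : ℝ) :
    x ∈ hyperplaneWithNormal (Pi.single i σ + Pi.single j τ) ↔ x i * σ + x j * τ = 0 := by
  simp [hyperplaneWithNormal, dotProduct_add]

theorem IsSignedPullback.exists_eq_iInter {n : ℕ} {V : Submodule ℝ (Fin n → ℝ)}
    (h : IsSignedPullback V) :
    ∃ N : Set (Fin n → ℝ), (∀ v ∈ N, IsSignedNormal v) ∧
      (V : Set (Fin n → ℝ)) = ⋂ v ∈ N, hyperplaneWithNormal v := by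
  classical
  obtain ⟨κ, c, s, hs, hV⟩ := h
  -- All admissible hyperplanes containing `V`; they include every equation `s i * x i = s j * x j`
  -- between coordinates sharing a parameter.
  refine ⟨{v | IsSignedNormal v ∧ (V : Set (Fin n → ℝ)) ⊆ hyperplaneWithNormal v},
    fun v hv => hv.1, Set.Subset.antisymm (fun x hx => Set.mem_iInter₂.2 fun v hv => hv.2 hx) ?_⟩
  intro x hx
  rw [Set.mem_iInter₂] at hx
  refine (hV x).2 ?_
  have hcmp : ∀ i j, c i = c j → s i ≠ 0 → s j ≠ 0 → s i * x i = s j * x j := by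
    intro i j hij hi hj
    by_cases hne : i = j
    · rw [hne]
    have hi' := (hs i).resolve_left hi
    have hj' := (hs j).resolve_left hj
    have hmem := hx (Pi.single i (s i) + Pi.single j (-s j)) ⟨⟨fun h0 => ?_, s i, -s j, hi', ?_,
      i, j, Or.inr rfl⟩, fun y hy => ?_⟩
    · rw [mem_hyperplaneWithNormal_add] at hmem
      linarith
    · have := congrFun h0 i
      simp [hne, hi] at this
    · rcases hj' with h | h <;> simp [h]
    · obtain ⟨t, ht⟩ := (hV y).1 hy
      rw [mem_hyperplaneWithNormal_add, ht i, ht j, hij]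
      rcases hi' with h | h <;> rcases hj' with h' | h' <;> simp [h, h']
  refine ⟨fun a => if h : ∃ i, c i = a ∧ s i ≠ 0 then s h.choose * x h.choose else 0,
    fun i => ?_⟩
  by_cases hi : s i = 0
  · have hmem := hx (Pi.single i 1) ⟨⟨by simp, 1, 1, Or.inl rfl, Or.inl rfl, i, i, Or.inl rfl⟩,
      fun y hy => ?_⟩
    · rw [mem_hyperplaneWithNormal_single] at hmem
      simpa [hi] using hmem
    · obtain ⟨t, ht⟩ := (hV y).1 hy
      rw [mem_hyperplaneWithNormal_single, ht i, hi]
      simp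
  · have hex : ∃ k, c k = c i ∧ s k ≠ 0 := ⟨i, rfl, hi⟩
    simp only [dif_pos hex]
    rw [hcmp _ _ hex.choose_spec.1 hex.choose_spec.2 hi, ← mul_assoc]
    rcases (hs i).resolve_left hi with h | h <;> simp [h]

theorem isSignedPullback_of_eq_iInter {n : ℕ} {V : Submodule ℝ (Fin n → ℝ)}
    {N : Set (Fin n → ℝ)} (hN : ∀ v ∈ N, IsSignedNormal v)
    (hV : (V : Set (Fin n → ℝ)) = ⋂ v ∈ N, hyperplaneWithNormal v) : IsSignedPullback V := by
  classical
  -- Defined from `V` rather than from `N`, so the classes already contain all consequences of the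
  -- equations.
  let R : Fin n → Fin n → Prop := fun i j =>
    ∃ σ : ℝ, (σ = 1 ∨ σ = -1) ∧ ∀ v ∈ V, v i = σ * v j
  have hR : Equivalence R := by
    refine ⟨fun i => ⟨1, by simp, by simp⟩, ?_, ?_⟩
    · rintro i j ⟨σ, hσ, h⟩
      refine ⟨σ, hσ, fun v hv => ?_⟩
      rw [h v hv]
      rcases hσ with h | h <;> simp [h]
    · rintro i j k ⟨σ, hσ, h⟩ ⟨τ, hτ, h'⟩
      refine ⟨σ * τ, ?_, fun v hv => by rw [h v hv, h' v hv, mul_assoc]⟩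
      rcases hσ with h | h <;> rcases hτ with h' | h' <;> simp [h, h']
  let S : Setoid (Fin n) := ⟨R, hR⟩
  have hout : ∀ i : Fin n, R i (Quotient.mk S i).out := fun i =>
    hR.symm (Quotient.exact (Quotient.out_eq (Quotient.mk S i)))
  choose σ hσ hσV using hout
  let s : Fin n → ℝ := fun i => if ∀ v ∈ V, v i = 0 then 0 else σ i
  refine ⟨Quotient S, Quotient.mk S, s, fun i => ?_, fun x => ⟨fun hx => ?_, ?_⟩⟩
  · by_cases h : ∀ v ∈ V, v i = 0
    · simp [s, if_pos h]
    · simpa only [s, if_neg h] using Or.inr (hσ i)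
  · refine ⟨fun a => x a.out, fun i => ?_⟩
    by_cases h : ∀ v ∈ V, v i = 0
    · simp [s, if_pos h, h x hx]
    · simpa only [s, if_neg h] using hσV i x hx
  · rintro ⟨t, ht⟩
    change x ∈ (V : Set (Fin n → ℝ))
    rw [hV, Set.mem_iInter₂]
    intro v hv
    have hsub : ∀ y ∈ V, y ∈ hyperplaneWithNormal v := fun y hy => by
      have : y ∈ (V : Set (Fin n → ℝ)) := hy
      rw [hV, Set.mem_iInter₂] at this
      exact this v hv
    obtain ⟨-, α, β, hα, hβ, i, j, rfl | rfl⟩ := hN v hv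
    · have hα0 : α ≠ 0 := by rcases hα with h | h <;> simp [h]
      have h0 : ∀ y ∈ V, y i = 0 := fun y hy => by
        simpa [mem_hyperplaneWithNormal_single, hα0] using hsub y hy
      rw [mem_hyperplaneWithNormal_single, ht i]
      simp [s, if_pos h0]
    · have h0 : ∀ y ∈ V, y i * α + y j * β = 0 := fun y hy => by
        simpa [mem_hyperplaneWithNormal_add] using hsub y hy
      have hα2 : α * α = 1 := by rcases hα with h | h <;> simp [h]
      have hij : ∀ y ∈ V, y i = (-(α * β)) * y j := fun y hy => by
        linear_combination α * h0 y hy - y i * hα2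
      have hRij : R i j :=
        ⟨-(α * β), by rcases hα with h | h <;> rcases hβ with h' | h' <;> simp [h, h'], hij⟩
      have hcij : Quotient.mk S i = Quotient.mk S j := Quotient.sound hRij
      have hne : α * β ≠ 0 := by
        rcases hα with h | h <;> rcases hβ with h' | h' <;> simp [h, h']
      have hiff : (∀ v ∈ V, v i = 0) ↔ ∀ v ∈ V, v j = 0 :=
        forall₂_congr fun y hy => by
          rw [hij y hy, mul_eq_zero, neg_eq_zero, or_iff_right hne]
      rw [mem_hyperplaneWithNormal_add, ht i, ht j, hcij]
      by_cases hz : ∀ v ∈ V, v i = 0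
      · simp [s, if_pos hz, if_pos (hiff.1 hz)]
      · have hs1 : s i = σ i := if_neg hz
        have hs2 : s j = σ j := if_neg (fun h => hz (hiff.2 h))
        push Not at hz
        obtain ⟨y, hy, hyi⟩ := hz
        have h1 := hσV i y hy
        have h2 := hσV j y hy
        rw [hcij] at h1
        have h3 := h0 y hy
        -- A vector of `V` nonzero on the class turns its normal equation into an identity between
        -- the signs.
        have hout0 : y (Quotient.mk S j).out ≠ 0 := fun h => hyi (by rw [h1, h, mul_zero])
        have h4 : σ i * α + σ j * β = 0 := by
          refine (mul_eq_zero.1 (?_ : (σ i * α + σ j * β) * y (Quotient.mk S j).out = 0)).resolve_right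
            hout0
          rw [h1, h2] at h3
          linarith
        rw [hs1, hs2]
        linear_combination t (Quotient.mk S j) * h4

/-! ### Strongly convex lines and their products. -/

/-- If some entry of a spanning vector `w` is not of maximal modulus, moving that entry of `w / 2`
slightly keeps a metric midpoint of `0` and `w` but leaves the line. -/
theorem exists_sign_span_of_isStronglyConvexSet {p : ℕ} (S : Submodule ℝ (Fin p → ℝ))
    (h1 : Module.finrank ℝ S = 1) (h2 : IsStronglyConvexSet (S : Set (Fin p → ℝ))) :
    ∃ ε : Fin p → ℝ, (∀ l, ε l = 1 ∨ ε l = -1) ∧ S = Submodule.span ℝ {ε} := by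
  obtain ⟨w, hw, hw0, hspan⟩ : ∃ w ∈ S, w ≠ 0 ∧ ∀ y ∈ S, ∃ a : ℝ, a • w = y := by
    obtain ⟨⟨w, hw⟩, hw0, hs⟩ := finrank_eq_one_iff'.1 h1
    refine ⟨w, hw, fun h => hw0 (Subtype.ext h), fun y hy => ?_⟩
    obtain ⟨a, ha⟩ := hs ⟨y, hy⟩
    exact ⟨a, congrArg Subtype.val ha⟩
  have hne : 0 < ‖w‖ := norm_pos_iff.2 hw0
  have : Nonempty (Fin p) := by
    by_contra hemp
    rw [not_nonempty_iff] at hemp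
    exact hw0 (Subsingleton.elim _ _)
  obtain ⟨i, hi⟩ : ∃ i, |w i| = ‖w‖ := by
    by_contra! hcon
    exact ((pi_norm_lt_iff hne).2 fun i => lt_of_le_of_ne (norm_le_pi_norm w i) (hcon i)).false
  have hall : ∀ l, |w l| = ‖w‖ := by
    classical
    intro l
    by_contra hl
    have hlt : |w l| < ‖w‖ := lt_of_le_of_ne (abs_apply_le_norm w l) hl
    have hil : i ≠ l := fun h => hl (h ▸ hi)
    set δ := (‖w‖ - |w l|) / 2 with hδ
    have hδ0 : 0 < δ := by rw [hδ]; linarith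
    let z : Fin p → ℝ := (1 / 2 : ℝ) • w + Pi.single l δ
    have hzl : z l = w l / 2 + δ := by simp [z]; ring
    have hzk : ∀ k, k ≠ l → z k = w k / 2 := fun k hk => by simp [z, hk]; ring
    have hlow : dist (0 : Fin p → ℝ) z ≤ ‖w‖ / 2 :=
      dist_le_of_abs_sub_le (by linarith) fun k => by
        by_cases hk : k = l
        · have h5 := abs_le.1 (le_refl |w l|)
          rw [hk, hzl, Pi.zero_apply, abs_le]
          constructor <;> linarith
        · have h5 := abs_le.1 (abs_apply_le_norm w k)
          rw [hzk k hk, Pi.zero_apply, abs_le]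
          constructor <;> linarith
    have hhigh : dist z w ≤ ‖w‖ / 2 :=
      dist_le_of_abs_sub_le (by linarith) fun k => by
        by_cases hk : k = l
        · have h5 := abs_le.1 (le_refl |w l|)
          rw [hk, hzl, abs_le]
          constructor <;> linarith
        · have h5 := abs_le.1 (abs_apply_le_norm w k)
          rw [hzk k hk, abs_le]
          constructor <;> linarith
    have hz : z ∈ S := h2.2 0 S.zero_mem w hw (by
      have h5 := dist_triangle 0 z w
      have h6 : dist 0 w = ‖w‖ := by simp
      change dist 0 z + dist z w = dist 0 w
      linarith)
    obtain ⟨a, ha⟩ := hspan z hz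
    have hai := congrFun ha i
    have hal := congrFun ha l
    rw [hzk i hil, Pi.smul_apply, smul_eq_mul] at hai
    rw [hzl, Pi.smul_apply, smul_eq_mul] at hal
    have hwi : w i ≠ 0 := fun h => by rw [h, abs_zero] at hi; linarith
    have ha2 : a = 1 / 2 := mul_right_cancel₀ hwi (by linarith)
    rw [ha2] at hal
    linarith
  refine ⟨‖w‖⁻¹ • w, fun l => ?_, le_antisymm (fun y hy => ?_) ?_⟩
  · apply eq_or_eq_neg_of_abs_eq
    rw [Pi.smul_apply, smul_eq_mul, abs_mul, hall l, abs_inv, abs_norm, inv_mul_cancel₀ hne.ne']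
  · obtain ⟨a, rfl⟩ := hspan y hy
    refine Submodule.mem_span_singleton.2 ⟨a * ‖w‖, ?_⟩
    rw [smul_smul, mul_assoc, mul_inv_cancel₀ hne.ne', mul_one]
  · rw [Submodule.span_singleton_le_iff_mem]
    exact S.smul_mem _ hw

/-- After the signs are removed, every entry of `z` lies between `a` and `b` within the same
distances `r` and `r'`, and `r + r' ≤ |a - b|` pins them all to one number. -/
theorem isStronglyConvexSet_span_sign {p : ℕ} (ε : Fin p → ℝ) (hε : ∀ l, ε l = 1 ∨ ε l = -1) :
    IsStronglyConvexSet (Submodule.span ℝ {ε} : Set (Fin p → ℝ)) := by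
  refine ⟨⟨0, Submodule.zero_mem _⟩, ?_⟩
  intro x hx y hy z hz
  obtain ⟨a, rfl⟩ := Submodule.mem_span_singleton.1 hx
  obtain ⟨b, rfl⟩ := Submodule.mem_span_singleton.1 hy
  change dist (a • ε) z + dist z (b • ε) = dist (a • ε) (b • ε) at hz
  set r := dist (a • ε) z
  set r' := dist z (b • ε)
  have hd : dist (a • ε) (b • ε) ≤ |a - b| := dist_le_of_abs_sub_le (abs_nonneg _) fun l => by
    simp only [Pi.smul_apply, smul_eq_mul, ← sub_mul, abs_mul]
    rcases hε l with h | h <;> simp [h]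
  have h1 : ∀ l, |a - ε l * z l| ≤ r := fun l => by
    have := abs_sub_le_of_dist_le (le_refl r) l
    simp only [Pi.smul_apply, smul_eq_mul] at this
    rcases hε l with h | h <;> rw [h] at this ⊢ <;> rw [abs_le] at this ⊢ <;>
      constructor <;> linarith
  have h2 : ∀ l, |ε l * z l - b| ≤ r' := fun l => by
    have := abs_sub_le_of_dist_le (le_refl r') l
    simp only [Pi.smul_apply, smul_eq_mul] at this
    rcases hε l with h | h <;> rw [h] at this ⊢ <;> rw [abs_le] at this ⊢ <;>
      constructor <;> linarith
  refine Submodule.mem_span_singleton.2 ⟨if b ≤ a then a - r else a + r, ?_⟩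
  ext l
  have h3 : ε l * z l = if b ≤ a then a - r else a + r := by
    have h4 := abs_le.1 (h1 l)
    have h5 := abs_le.1 (h2 l)
    split_ifs with hab
    · rw [abs_of_nonneg (sub_nonneg.2 hab)] at hd
      linarith
    · rw [abs_of_neg (by linarith)] at hd
      linarith
  rw [← h3, Pi.smul_apply, smul_eq_mul]
  rcases hε l with h | h <;> simp [h]

theorem IsStronglyConvexLineProduct.mem_iff {n : ℕ} {V : Submodule ℝ (Fin n → ℝ)} {k m q : ℕ}
    {p : Fin q → ℕ} {S : (j : Fin q) → Submodule ℝ (Fin (p j) → ℝ)}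
    {e : Fin n ≃ Fin k ⊕ Fin m ⊕ ((j : Fin q) × Fin (p j))}
    (h : IsStronglyConvexLineProduct V k m S e) {ε : (j : Fin q) → Fin (p j) → ℝ}
    (hS : ∀ j, S j = Submodule.span ℝ {ε j}) (x : Fin n → ℝ) :
    x ∈ V ↔ ∃ t : Fin m ⊕ Fin q → ℝ, ∀ i, x i =
      Sum.elim (fun _ => 0) (Sum.elim (fun a => t (Sum.inl a))
        (fun w => ε w.1 w.2 * t (Sum.inr w.1))) (e i) := by
  change x ∈ (V : Set (Fin n → ℝ)) ↔ _
  rw [h.2]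
  constructor
  · rintro ⟨h0, hj⟩
    have : ∀ j, ∃ a : ℝ, a • ε j = fun l => x (e.symm (Sum.inr (Sum.inr ⟨j, l⟩))) := fun j =>
      Submodule.mem_span_singleton.1 (hS j ▸ hj j)
    choose a ha using this
    refine ⟨Sum.elim (fun b => x (e.symm (Sum.inr (Sum.inl b)))) a, fun i => ?_⟩
    obtain ⟨w, rfl⟩ := e.symm.surjective i
    rw [Equiv.apply_symm_apply]
    rcases w with w | w | ⟨j, l⟩
    · exact h0 w
    · rfl
    · simpa [mul_comm] using (congrFun (ha j) l).symm
  · rintro ⟨t, ht⟩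
    refine ⟨fun i => by simp [ht], fun j => ?_⟩
    rw [hS j]
    refine Submodule.mem_span_singleton.2 ⟨t (Sum.inr j), ?_⟩
    ext l
    simp [ht, mul_comm]

theorem IsStronglyConvexLineProduct.isSignedPullback {n : ℕ} {V : Submodule ℝ (Fin n → ℝ)}
    {k m q : ℕ} {p : Fin q → ℕ} {S : (j : Fin q) → Submodule ℝ (Fin (p j) → ℝ)}
    {e : Fin n ≃ Fin k ⊕ Fin m ⊕ ((j : Fin q) × Fin (p j))}
    (h : IsStronglyConvexLineProduct V k m S e) : IsSignedPullback V := by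
  choose ε hε hS using fun j => exists_sign_span_of_isStronglyConvexSet (S j) (h.1 j).1 (h.1 j).2
  -- `none` is a dummy parameter for the coordinates that vanish.
  refine ⟨Option (Fin m ⊕ Fin q),
    fun i => Sum.elim (fun _ => none)
      (Sum.elim (fun a => some (Sum.inl a)) (fun w => some (Sum.inr w.1))) (e i),
    fun i => Sum.elim (fun _ => 0) (Sum.elim (fun _ => 1) (fun w => ε w.1 w.2)) (e i),
    fun i => ?_, fun x => ?_⟩
  · dsimp only
    rcases e i with w | w | ⟨j, l⟩
    · simp
    · simp
    · exact Or.inr (hε j l)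
  · rw [h.mem_iff hS]
    constructor
    · rintro ⟨t, ht⟩
      refine ⟨fun o => o.elim 0 t, fun i => ?_⟩
      rw [ht i]
      rcases hw : e i with w | w | ⟨j, l⟩ <;> simp [hw]
    · rintro ⟨t, ht⟩
      refine ⟨fun a => t (some a), fun i => ?_⟩
      rw [ht i]
      rcases hw : e i with w | w | ⟨j, l⟩ <;> simp [hw]

theorem IsStronglyConvexLineProduct.finrank_eq {n : ℕ} {V : Submodule ℝ (Fin n → ℝ)}
    {k m q : ℕ} {p : Fin q → ℕ} {S : (j : Fin q) → Submodule ℝ (Fin (p j) → ℝ)}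
    {e : Fin n ≃ Fin k ⊕ Fin m ⊕ ((j : Fin q) × Fin (p j))}
    (h : IsStronglyConvexLineProduct V k m S e) : Module.finrank ℝ V = m + q := by
  choose ε hε hS using fun j => exists_sign_span_of_isStronglyConvexSet (S j) (h.1 j).1 (h.1 j).2
  -- An empty block would make its parameter invisible and `T` non-injective.
  have hp : ∀ j, Nonempty (Fin (p j)) := fun j => by
    by_contra hemp
    rw [not_nonempty_iff] at hemp
    have := (h.1 j).1
    rw [Module.finrank_zero_of_subsingleton] at this
    exact zero_ne_one this
  let T : (Fin m ⊕ Fin q → ℝ) →ₗ[ℝ] (Fin n → ℝ) :=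
    { toFun := fun t i => Sum.elim (fun _ => 0) (Sum.elim (fun a => t (Sum.inl a))
        (fun w => ε w.1 w.2 * t (Sum.inr w.1))) (e i)
      map_add' := fun t t' => by
        ext i
        rcases hw : e i with w | w | ⟨j, l⟩ <;> simp [hw, mul_add]
      map_smul' := fun a t => by
        ext i
        rcases hw : e i with w | w | ⟨j, l⟩ <;> simp [hw, mul_left_comm] }
  have hT : Function.Injective T := by
    rw [← LinearMap.ker_eq_bot, LinearMap.ker_eq_bot']
    intro t ht
    ext a
    rcases a with a | j
    · simpa [T] using congrFun ht (e.symm (Sum.inr (Sum.inl a)))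
    · obtain ⟨l⟩ := hp j
      have := congrFun ht (e.symm (Sum.inr (Sum.inr ⟨j, l⟩)))
      rcases hε j l with h' | h' <;> simpa [T, h'] using this
  have hrange : LinearMap.range T = V := by
    ext x
    rw [h.mem_iff hS, LinearMap.mem_range]
    exact exists_congr fun t => by rw [funext_iff]; exact forall_congr' fun i => eq_comm
  rw [← hrange, LinearMap.finrank_range_of_inj hT]
  simp

theorem IsSignedPullback.exists_isStronglyConvexLineProduct {n : ℕ}
    {V : Submodule ℝ (Fin n → ℝ)} (h : IsSignedPullback V) :
    ∃ (k m q : ℕ) (p : Fin q → ℕ) (S : (j : Fin q) → Submodule ℝ (Fin (p j) → ℝ))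
      (e : Fin n ≃ Fin k ⊕ Fin m ⊕ ((j : Fin q) × Fin (p j))),
      IsStronglyConvexLineProduct V k m S e := by
  classical
  obtain ⟨κ, c, s, hs, hV⟩ := h
  -- Only parameters in actual use give one-dimensional blocks. Unshared ones become blocks of
  -- length 1, so `m = 0` suffices.
  let K : Finset κ := (Finset.univ.filter fun i => s i ≠ 0).image c
  let g : Fin K.card ≃ K := K.equivFin.symm
  let z : Fin (Fintype.card {i // s i = 0}) ≃ {i // s i = 0} := (Fintype.equivFin _).symm
  let f : (j : Fin K.card) → Fin (Fintype.card {i // s i ≠ 0 ∧ c i = g j}) ≃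
      {i // s i ≠ 0 ∧ c i = g j} := fun j => (Fintype.equivFin _).symm
  let φ : Fin (Fintype.card {i // s i = 0}) ⊕ Fin 0 ⊕
      ((j : Fin K.card) × Fin (Fintype.card {i // s i ≠ 0 ∧ c i = g j})) → Fin n :=
    Sum.elim (fun a => z a) (Sum.elim (fun a => a.elim0) (fun w => f w.1 w.2))
  have hφ : Function.Bijective φ := by
    constructor
    · rintro (a | a | ⟨j, l⟩) (b | b | ⟨j', l'⟩) hab
      · exact congrArg Sum.inl (z.injective (Subtype.ext hab))
      · exact b.elim0
      · exact absurd ((congrArg s hab).symm.trans (z a).2) (f j' l').2.1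
      · exact a.elim0
      · exact a.elim0
      · exact a.elim0
      · exact absurd ((congrArg s hab).trans (z b).2) (f j l).2.1
      · exact b.elim0
      · have hab' : (f j l : Fin n) = f j' l' := hab
        have hj : j = j' := g.injective (Subtype.ext (by
          rw [← (f j l).2.2, ← (f j' l').2.2, hab']))
        subst hj
        have hl : l = l' := (f j).injective (Subtype.ext hab')
        rw [hl]
    · intro i
      by_cases hi : s i = 0
      · exact ⟨Sum.inl (z.symm ⟨i, hi⟩), by simp [φ]⟩
      · have hK : c i ∈ K := Finset.mem_image.2 ⟨i, by simp [hi], rfl⟩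
        exact ⟨Sum.inr (Sum.inr ⟨g.symm ⟨c i, hK⟩, (f _).symm ⟨i, hi, by simp⟩⟩), by simp [φ]⟩
  have hsign : ∀ j l, s (f j l) = 1 ∨ s (f j l) = -1 := fun j l =>
    (hs _).resolve_left (f j l).2.1
  refine ⟨_, 0, K.card, _, fun j => Submodule.span ℝ {fun l => s (f j l)},
    (Equiv.ofBijective φ hφ).symm, fun j => ⟨finrank_span_singleton fun h0 => ?_,
      isStronglyConvexSet_span_sign _ (hsign j)⟩, ?_⟩
  · obtain ⟨i, hi, hij⟩ := Finset.mem_image.1 (g j).2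
    have := congrFun h0 ((f j).symm ⟨i, (Finset.mem_filter.1 hi).2, hij⟩)
    simp only [Equiv.apply_symm_apply, Pi.zero_apply] at this
    exact (Finset.mem_filter.1 hi).2 this
  · ext x
    change x ∈ V ↔ (∀ a, x (z a) = 0) ∧
      ∀ j, (fun l => x (f j l)) ∈ Submodule.span ℝ {fun l => s (f j l)}
    rw [hV]
    constructor
    · rintro ⟨t, ht⟩
      refine ⟨fun a => by rw [ht, (z a).2, zero_mul], fun j => ?_⟩
      refine Submodule.mem_span_singleton.2 ⟨t (g j), ?_⟩
      ext l
      rw [ht, (f j l).2.2, Pi.smul_apply, smul_eq_mul, mul_comm]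
    · rintro ⟨h0, hj⟩
      choose a ha using fun j => Submodule.mem_span_singleton.1 (hj j)
      let t : κ → ℝ := fun b => if hb : b ∈ K then a (g.symm ⟨b, hb⟩) else 0
      have ht : ∀ j, t (g j) = a j := fun j => by simp [t]
      refine ⟨t, fun i => ?_⟩
      obtain ⟨w, rfl⟩ := hφ.2 i
      rcases w with w | w | ⟨j, l⟩
      · change x (z w) = s (z w) * _
        rw [h0, (z w).2, zero_mul]
      · exact w.elim0
      · have := congrFun (ha j) l
        simp only [Pi.smul_apply, smul_eq_mul] at this
        change x (f j l) = s (f j l) * t (c (f j l))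
        rw [(f j l).2.2, ht, ← this, mul_comm]

theorem mainTheorem5 (n : ℕ) (hn : 1 ≤ n) (V : Submodule ℝ (Fin n → ℝ)) :
    (IsWeaklyExternallyHyperconvex (V : Set (Fin n → ℝ)) ↔
      ∃ N : Set (Fin n → ℝ), (∀ v ∈ N, IsSignedNormal v) ∧
        (V : Set (Fin n → ℝ)) = ⋂ v ∈ N, hyperplaneWithNormal v) ∧
    (IsWeaklyExternallyHyperconvex (V : Set (Fin n → ℝ)) ↔
      ∃ (k m q : ℕ) (p : Fin q → ℕ) (S : (j : Fin q) → Submodule ℝ (Fin (p j) → ℝ))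
        (e : Fin n ≃ Fin k ⊕ Fin m ⊕ ((j : Fin q) × Fin (p j))),
        IsStronglyConvexLineProduct V k m S e) ∧
    (∀ (k m q : ℕ) (p : Fin q → ℕ) (S : (j : Fin q) → Submodule ℝ (Fin (p j) → ℝ))
        (e : Fin n ≃ Fin k ⊕ Fin m ⊕ ((j : Fin q) × Fin (p j))),
        IsStronglyConvexLineProduct V k m S e →
          n = k + m + ∑ j, p j ∧ Module.finrank ℝ V = m + q ∧
          ∀ j, ∃ ε : Fin (p j) → ℝ, (∀ l, ε l = 1 ∨ ε l = -1) ∧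
            S j = Submodule.span ℝ {ε}) := by
  have h12 : IsWeaklyExternallyHyperconvex (V : Set (Fin n → ℝ)) ↔ IsSignedPullback V :=
    ⟨fun h => h.isSignedPullback, fun h => h.isWeaklyExternallyHyperconvex⟩
  refine ⟨h12.trans ⟨fun h => h.exists_eq_iInter, ?_⟩,
    h12.trans ⟨fun h => h.exists_isStronglyConvexLineProduct, ?_⟩, ?_⟩
  · rintro ⟨N, hN, hV⟩
    exact isSignedPullback_of_eq_iInter hN hV
  · rintro ⟨k, m, q, p, S, e, h⟩
    exact h.isSignedPullback
  · intro k m q p S e h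
    refine ⟨?_, h.finrank_eq,
      fun j => exists_sign_span_of_isStronglyConvexSet (S j) (h.1 j).1 (h.1 j).2⟩
    have := Fintype.card_congr e
    simpa [add_assoc] using this
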